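/- Let $0<r<d$ be integers, and for $a,b>0$, $0\le x\le 1$ let $I_x(a,b)=\frac{1}{B(a,b)}\int_0^x t^{a-1}(1-t)^{b-1}\,dt$ be the regularised incomplete beta function. Then $$I_{1/2}(r,d-r)-I_{r/d}(r,d-r)<\tfrac12 .$$ Moreover, for every finite non-empty set $S$ of orthogonal projectors of rank $r$ on $\mathbb{C}^d$, fewer than half of the members of $S$ require a contextual valuation, in the following sense. For a set $X$ of projectors on $\mathbb{C}^d$, a context of $X$ is a finite set of members of $X$ summing to the identity, and a valuation of $X$ with values in $\{0,C,1\}$ ($C$ meaning "contextual") is admissible if every context of $X$ contains a projector valued $1$ or $C$, and no two orthogonal members of $X$ are both valued $1$. Given a valuation $f$ of the rank-one projectors, the inherited valuation $g_f$ of an orthogonal projector $P$ is: $0$ if $P=\sum_i|\psi_i\rangle\langle\psi_i|$ for some orthonormal $\psi_i$ with all $f(|\psi_i\rangle\langle\psi_i|)=0$; otherwise $1$ if there is such a decomposition with all $f(|\psi_i\rangle\langle\psi_i|)\in\{0,1\}$; otherwise $C$. Then there is an admissible valuation $f$ of the set of all rank-one projectors on $\mathbb{C}^d$ such that $g_f$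 is admissible on $S$ and $$\frac{|\{P\in S: g_f(P)=C\}|}{|S|}<\tfrac12 .$$ -/

import Mathlib

/-- The regularised incomplete beta function
`I_x(a, b) = B(a, b)⁻¹ ∫₀ˣ t^(a-1) (1-t)^(b-1) dt`. -/
noncomputable def regIncBeta (x a b : ℝ) : ℝ :=
  (∫ t in (0 : ℝ)..x, t ^ (a - 1) * (1 - t) ^ (b - 1)) / ProbabilityTheory.beta a b

/-- The `d`-dimensional complex Hilbert space. -/
abbrev QSpace (d : ℕ) : Type := EuclideanSpace ℂ (Fin d)

/-- Operators on the `d`-dimensional complex Hilbert space. -/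
abbrev QOp (d : ℕ) : Type := QSpace d →L[ℂ] QSpace d

/-- The possible valuations of a projector: noncontextually `0`, noncontextually `1`,
or contextual (`C`). -/
inductive Valuation01C : Type
  | zero
  | contextual
  | one

/-- `P` is an orthogonal projector of rank `r`. -/
def IsRankProjector {d : ℕ} (r : ℕ) (P : QOp d) : Prop :=
  IsStarProjection P ∧ Module.finrank ℂ (P : QSpace d →ₗ[ℂ] QSpace d).range = r

/-- The set of all rank-one projectors `|ψ⟩⟨ψ|` (pure states up to phase). -/
def rankOneProjectors (d : ℕ) : Set (QOp d) := {P | IsRankProjector 1 P}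

/-- A context of a set `S` of projectors: finitely many distinct members of `S` which sum to the
identity (for projectors this forces them to be pairwise orthogonal). -/
def IsContext {d : ℕ} (S : Set (QOp d)) (c : Finset (QOp d)) : Prop :=
  (∀ P ∈ c, P ∈ S) ∧ ∑ P ∈ c, P = 1

/-- The rules for a valuation of a set `S` of projectors: every context contains a projector
valued `1` or `C`, and two orthogonal projectors are never both valued `1` (so no context contains
more than one projector valued `1`). -/
structure IsAdmissible {d : ℕ} (S : Set (QOp d)) (v : QOp d → Valuation01C) : Prop where
  exists_ne_zero : ∀ c : Finset (QOp d), IsContext S c → ∃ P ∈ c, v P ≠ Valuation01C.zero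
  not_both_one : ∀ P ∈ S, ∀ Q ∈ S, P * Q = 0 →
    ¬ (v P = Valuation01C.one ∧ v Q = Valuation01C.one)

/-- `ψ` is a decomposition of the projector `P` into rank-one projectors:
`P = ∑ i, |ψ i⟩⟨ψ i|` with the `ψ i` orthonormal. -/
def IsDecomposition {d n : ℕ} (P : QOp d) (ψ : Fin n → QSpace d) : Prop :=
  Orthonormal ℂ ψ ∧ P = ∑ i, InnerProductSpace.rankOne ℂ (ψ i) (ψ i)

open Classical in
/-- The valuation of all projectors inherited from a valuation `f` of the rank-one projectors:
`0` if some decomposition of `P` into rank-one projectors has all its members valued `0`;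
otherwise `1` if some decomposition has all its members valued `0` or `1`; otherwise `C`. -/
noncomputable def inheritedValuation {d : ℕ} (f : QOp d → Valuation01C) (P : QOp d) :
    Valuation01C :=
  if ∃ (n : ℕ) (ψ : Fin n → QSpace d), IsDecomposition P ψ ∧
      ∀ i, f (InnerProductSpace.rankOne ℂ (ψ i) (ψ i)) = Valuation01C.zero then
    Valuation01C.zero
  else if ∃ (n : ℕ) (ψ : Fin n → QSpace d), IsDecomposition P ψ ∧
      ∀ i, f (InnerProductSpace.rankOne ℂ (ψ i) (ψ i)) = Valuation01C.zero ∨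
        f (InnerProductSpace.rankOne ℂ (ψ i) (ψ i)) = Valuation01C.one then
    Valuation01C.one
  else Valuation01C.contextual

open Classical in
/-- The number of projectors in `S` to which `v` gives a contextual valuation. -/
noncomputable def contextualCount {d : ℕ} (S : Finset (QOp d)) (v : QOp d → Valuation01C) : ℕ :=
  (S.filter fun P => v P = Valuation01C.contextual).card

/-!
A pure state `φ` defines a valuation of the rank-one projectors (`overlapValuation`): writing
`p = ‖P φ‖ ^ 2 / ‖φ‖ ^ 2`, a projector is valued `0` if `p < 1 / d`, `1` if `p > 1 / 2`, and `C`
otherwise.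
It is admissible, because the values of `p` in a context add up to `1`, so that they are not all below
average, and because two orthogonal projectors cannot both have `p > 1 / 2`. The same reasoning makes
the inherited valuation admissible on projectors of rank `r`, with threshold `r / d` in place of
`1 / d`.

The inherited valuation of `P` is contextual only if `r / d ≤ p ≤ 1 / 2`
(`bounds_of_inheritedValuation_eq_contextual`): if `p < r / d`, the range of `P` has an orthonormal
basis with all overlaps equal to `p / r < 1 / d`, and if `p > 1 / 2`, it has one whose first vector is
proportional to `P φ` and whose other vectors are orthogonal to `φ`.

For a Gaussian random `φ` the number `p` has the beta distribution with parameters `r` and `d - r`,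
whose mean is `m = r / d`. If `m ≤ 1 / 2`, its median is at most its mean, so that `p` lies in
`[m, 1 / 2]` with probability less than one half, since `p > 1 / 2` has positive probability; if
`m > 1 / 2`, the interval is empty. Averaging over `φ`, some `φ` makes fewer than half of the members
of `S` contextual (`exists_two_mul_contextualCount_lt`).

The comparison of median and mean (`integral_beta_mean_one_le`) rests on the function
`G t = t ^ r * (1 - t) ^ (d - r)`, whose derivative is `d * (m - t)` times the density. Since
`G (m + s) ≥ G (m - s)`, an integration by parts against `1 / s` shows that no more mass lies to the
right of `m` than to the left.

The lemmas about integrals write `r = p + 1` and `d - r = q + 1` with natural numbers `p`, `q`, so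
that the exponents of the density are `p` and `q`.
-/

section ContextualValuations

open Set MeasureTheory Filter Topology InnerProductSpace
open scoped ENNReal

/-! ### Mean and median of the beta distribution -/

/-- With `m` the mean of the beta density, `t ^ (p + 1) * (1 - t) ^ (q + 1)` is, up to the factor
`p + q + 2`, a primitive of `m - t` times the unnormalised density `t ^ p * (1 - t) ^ q`. -/
theorem hasDerivAt_betaPrimitive (p q : ℕ) {m : ℝ} (hm : m * (p + q + 2) = p + 1) (t : ℝ) :
    HasDerivAt (fun t : ℝ => t ^ (p + 1) * (1 - t) ^ (q + 1))
      (((p : ℝ) + q + 2) * (m - t) * (t ^ p * (1 - t) ^ q)) t := by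
  have h1 : HasDerivAt (fun t : ℝ => t ^ (p + 1)) (((p + 1 : ℕ) : ℝ) * t ^ p) t := by
    simpa using hasDerivAt_pow (p + 1) t
  have h2 : HasDerivAt (fun t : ℝ => (1 - t) ^ (q + 1))
      (((q + 1 : ℕ) : ℝ) * (1 - t) ^ q * (-1)) t := by
    simpa using ((hasDerivAt_id t).const_sub 1).fun_pow (q + 1)
  refine (h1.mul h2).congr_deriv ?_
  push_cast
  linear_combination (-t ^ p * (1 - t) ^ q) * hm

/-- If the mean `m` is at most `1 / 2`, then `t ^ (p + 1) * (1 - t) ^ (q + 1)`, which peaks at `m`,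
falls off more slowly to the right of `m` than to the left. -/
theorem betaPrimitive_reflect_le (p q : ℕ) {m : ℝ} (hm : m * (p + q + 2) = p + 1)
    (hm2 : m ≤ 1 / 2) {s : ℝ} (hs : 0 ≤ s) (hsm : s ≤ m) :
    (m - s) ^ (p + 1) * (1 - (m - s)) ^ (q + 1) ≤ (m + s) ^ (p + 1) * (1 - (m + s)) ^ (q + 1) := by
  have hm0 : 0 < m := by
    by_contra h
    have : m * (p + q + 2) ≤ 0 := mul_nonpos_of_nonpos_of_nonneg (not_lt.1 h) (by positivity)
    have : (0 : ℝ) < p + 1 := by positivity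
    linarith
  rcases hsm.eq_or_lt with rfl | hlt
  · have : 0 ≤ 1 - (s + s) := by linarith
    simp only [sub_self, zero_pow (Nat.succ_ne_zero p), zero_mul]
    positivity
  -- The logarithm of the quotient of the two sides is monotone in `s` and vanishes at `s = 0`.
  let L : ℝ → ℝ := fun s => ((p + 1 : ℕ) : ℝ) * (Real.log (m + s) - Real.log (m - s)) -
    ((q + 1 : ℕ) : ℝ) * (Real.log (1 - m + s) - Real.log (1 - m - s))
  have hder : ∀ x ∈ Ico 0 m, HasDerivAt L (((p + 1 : ℕ) : ℝ) * (1 / (m + x) - (-1) / (m - x)) -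
      ((q + 1 : ℕ) : ℝ) * (1 / (1 - m + x) - (-1) / (1 - m - x))) x := by
    intro x hx
    have h1 := ((hasDerivAt_id x).const_add m).log (by simp only [id]; linarith [hx.1])
    have h2 := ((hasDerivAt_id x).const_sub m).log (by simp only [id]; linarith [hx.2])
    have h3 := ((hasDerivAt_id x).const_add (1 - m)).log (by simp only [id]; linarith [hx.1])
    have h4 := ((hasDerivAt_id x).const_sub (1 - m)).log (by simp only [id]; linarith [hx.2])
    exact ((h1.sub h2).const_mul _).sub ((h3.sub h4).const_mul _)
  have hmono : MonotoneOn L (Ico 0 m) := by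
    refine monotoneOn_of_deriv_nonneg (convex_Ico 0 m)
      (fun x hx => (hder x hx).continuousAt.continuousWithinAt) ?_ ?_
    · intro x hx
      rw [interior_Ico] at hx
      exact (hder x (Ioo_subset_Ico_self hx)).differentiableAt.differentiableWithinAt
    · intro x hx
      rw [interior_Ico] at hx
      rw [(hder x (Ioo_subset_Ico_self hx)).deriv]
      obtain ⟨hx0, hxm⟩ := hx
      have e1 : 0 < m - x := by linarith
      have e2 : 0 < m + x := by linarith
      have e3 : 0 < 1 - m + x := by linarith
      have e4 : 0 < 1 - m - x := by linarith
      have hp : ((p + 1 : ℕ) : ℝ) = (p + q + 2) * m := by push_cast; linarith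
      have hq : ((q + 1 : ℕ) : ℝ) = (p + q + 2) * (1 - m) := by push_cast; linarith
      rw [hp, hq]
      have : (p + q + 2) * m * (1 / (m + x) - (-1) / (m - x)) -
          (p + q + 2) * (1 - m) * (1 / (1 - m + x) - (-1) / (1 - m - x)) =
          2 * (p + q + 2) * x ^ 2 * (1 - 2 * m) /
            ((m + x) * (m - x) * (1 - m + x) * (1 - m - x)) := by
        field_simp
        ring
      rw [this]
      have : 0 ≤ 1 - 2 * m := by linarith
      positivity
  have hL := hmono ⟨le_rfl, hm0⟩ ⟨hs, hlt⟩ hs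
  simp only [L, add_zero, sub_zero, sub_self, mul_zero] at hL
  have e1 : 0 < m - s := by linarith
  have e2 : 0 < m + s := by linarith
  have e3 : 0 < 1 - m + s := by linarith
  have e4 : 0 < 1 - m - s := by linarith
  rw [show 1 - (m - s) = 1 - m + s by ring, show 1 - (m + s) = 1 - m - s by ring,
    ← Real.log_le_log_iff (by positivity) (by positivity),
    Real.log_mul (by positivity) (by positivity), Real.log_mul (by positivity) (by positivity),
    Real.log_pow, Real.log_pow, Real.log_pow, Real.log_pow]
  linarith

/-- The median of a beta distribution with mean `m ≤ 1 / 2` is at most `m`: at least half of the mass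
lies to the left of `m`. -/
theorem integral_beta_mean_one_le (p q : ℕ) {m : ℝ} (hm : m * (p + q + 2) = p + 1)
    (hm2 : m ≤ 1 / 2) :
    ∫ t in m..1, t ^ p * (1 - t) ^ q ≤ ∫ t in (0 : ℝ)..m, t ^ p * (1 - t) ^ q := by
  set f : ℝ → ℝ := fun t => t ^ p * (1 - t) ^ q with hf
  set G : ℝ → ℝ := fun t => t ^ (p + 1) * (1 - t) ^ (q + 1) with hG
  set N : ℝ := (p : ℝ) + q + 2 with hN
  have hN0 : 0 < N := by positivity
  have hm0 : 0 < m := by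
    by_contra h
    have : m * N ≤ 0 := mul_nonpos_of_nonpos_of_nonneg (not_lt.1 h) hN0.le
    have : (0 : ℝ) < p + 1 := by positivity
    linarith
  have hfc : Continuous f := by fun_prop
  have hii : ∀ a b : ℝ, IntervalIntegrable f volume a b := fun a b => hfc.intervalIntegrable a b
  have hGd : ∀ t, HasDerivAt G (N * (m - t) * f t) t := hasDerivAt_betaPrimitive p q hm
  -- `F s` is the excess of mass of `[m, m + s]` over `[m - s, m]`, and `E' s = -N * s * F' s`.
  let E : ℝ → ℝ := fun s => G (m + s) - G (m - s)
  let F : ℝ → ℝ := fun s => (∫ t in m..(m + s), f t) + ∫ t in m..(m - s), f t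
  have hEd : ∀ s, HasDerivAt E (-(N * s * (f (m + s) - f (m - s)))) s := by
    intro s
    have h1 := (hGd (m + s)).comp s ((hasDerivAt_id s).const_add m)
    have h2 := (hGd (m - s)).comp s ((hasDerivAt_id s).const_sub m)
    exact (h1.sub h2).congr_deriv (by ring)
  have hFd : ∀ s, HasDerivAt F (f (m + s) - f (m - s)) s := by
    intro s
    have h0 : ∀ x, HasDerivAt (fun x => ∫ t in m..x, f t) (f x) x := fun x =>
      hfc.integral_hasStrictDerivAt m x |>.hasDerivAt
    have h1 := (h0 (m + s)).comp s ((hasDerivAt_id s).const_add m)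
    have h2 := (h0 (m - s)).comp s ((hasDerivAt_id s).const_sub m)
    exact (h1.add h2).congr_deriv (by ring)
  have hE0 : E 0 = 0 := by simp [E]
  have hF0 : F 0 = 0 := by simp [F]
  -- In the derivative of `H` the terms with `F'` and `E'` cancel, which leaves `-E s / s ^ 2 ≤ 0`.
  let H : ℝ → ℝ := fun s => N * F s + E s / s
  have hHd : ∀ s ∈ Ioc 0 m, HasDerivAt H (-(E s / s ^ 2)) s := by
    intro s hs
    have hs0 : s ≠ 0 := hs.1.ne'
    refine (((hFd s).const_mul N).add ((hEd s).div (hasDerivAt_id s) hs0)).congr_deriv ?_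
    simp only [id]
    field_simp
    ring
  have hanti : AntitoneOn H (Ioc 0 m) := by
    refine antitoneOn_of_deriv_nonpos (convex_Ioc 0 m)
      (fun x hx => (hHd x hx).continuousAt.continuousWithinAt) ?_ ?_
    · intro x hx
      rw [interior_Ioc] at hx
      exact (hHd x (Ioo_subset_Ioc_self hx)).differentiableAt.differentiableWithinAt
    · intro x hx
      rw [interior_Ioc] at hx
      rw [(hHd x (Ioo_subset_Ioc_self hx)).deriv]
      have : 0 ≤ E x := sub_nonneg.2 (betaPrimitive_reflect_le p q hm hm2 hx.1.le hx.2.le)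
      have : 0 ≤ E x / x ^ 2 := by positivity
      linarith
  have hlim : Tendsto H (𝓝[>] 0) (𝓝 0) := by
    have h1 : Tendsto (fun s => N * F s) (𝓝[>] 0) (𝓝 0) := by
      have := ((hFd 0).continuousAt.const_mul N).tendsto
      rw [hF0, mul_zero] at this
      exact this.mono_left nhdsWithin_le_nhds
    have h2 : Tendsto (fun s => E s / s) (𝓝[>] 0) (𝓝 0) := by
      have := (hEd 0).tendsto_slope_zero_right
      simp only [zero_add, hE0, sub_zero, smul_eq_mul, mul_zero, zero_mul, neg_zero] at this
      exact this.congr fun s => by rw [div_eq_inv_mul]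
    simpa using h1.add h2
  have hHm : H m ≤ 0 := by
    refine ge_of_tendsto hlim ?_
    filter_upwards [Ioo_mem_nhdsGT hm0] with s hs
    exact hanti ⟨hs.1, hs.2.le⟩ ⟨hm0, le_rfl⟩ hs.2.le
  have hEm : E m = G (2 * m) := by simp [E, hG, two_mul]
  have hFm : F m = (∫ t in m..(2 * m), f t) - ∫ t in (0 : ℝ)..m, f t := by
    simp only [F, sub_self]
    rw [intervalIntegral.integral_symm 0 m, two_mul, sub_eq_add_neg]
  -- Beyond `2 * m` there is no mirror image, but there `t - m ≥ m`.
  have htail : N * m * ∫ t in (2 * m)..1, f t ≤ G (2 * m) := by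
    have hint : ∫ t in (2 * m)..1, N * (m - t) * f t = G 1 - G (2 * m) :=
      intervalIntegral.integral_eq_sub_of_hasDerivAt (fun t _ => hGd t)
        (Continuous.intervalIntegrable (by fun_prop) _ _)
    have hG1 : G 1 = 0 := by simp [hG]
    rw [← intervalIntegral.integral_const_mul]
    calc ∫ t in (2 * m)..1, N * m * f t
        ≤ ∫ t in (2 * m)..1, -(N * (m - t) * f t) := by
          refine intervalIntegral.integral_mono_on (by linarith)
            (Continuous.intervalIntegrable (by fun_prop) _ _)
            (Continuous.intervalIntegrable (by fun_prop) _ _) fun t ht => ?_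
          have hft : 0 ≤ f t := mul_nonneg (pow_nonneg (by linarith [ht.1]) _)
            (pow_nonneg (by linarith [ht.2]) _)
          have : 0 ≤ N * (t - 2 * m) * f t :=
            mul_nonneg (mul_nonneg hN0.le (by linarith [ht.1])) hft
          linarith
      _ = G (2 * m) := by rw [intervalIntegral.integral_neg, hint, hG1]; ring
  have hsplit : ∫ t in m..1, f t = (∫ t in m..(2 * m), f t) + ∫ t in (2 * m)..1, f t :=
    (intervalIntegral.integral_add_adjacent_intervals (hii _ _) (hii _ _)).symm
  have hHm' : N * F m * m + G (2 * m) ≤ 0 := by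
    have := mul_nonpos_of_nonpos_of_nonneg hHm hm0.le
    simp only [H, hEm] at this
    field_simp at this
    linarith
  rw [hFm] at hHm'
  have hNm : 0 < N * m := by positivity
  have : N * m * ((∫ t in m..1, f t) - ∫ t in (0 : ℝ)..m, f t) ≤ 0 := by
    rw [hsplit]; linarith
  linarith [nonpos_of_mul_nonpos_right this hNm]

/-- The form of `integral_beta_mean_one_le` in which the mass to the right of `1 / 2` is separated; only
the rest of the mass to the right of `m` belongs to the contextual states. -/
theorem integral_beta_mean_half_le (p q : ℕ) {m : ℝ} (hm : m * (p + q + 2) = p + 1)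
    (hm2 : m ≤ 1 / 2) :
    (∫ t in m..(1 / 2), t ^ p * (1 - t) ^ q) + ∫ t in (1 / 2)..1, t ^ p * (1 - t) ^ q
      ≤ ∫ t in (0 : ℝ)..m, t ^ p * (1 - t) ^ q := by
  rw [intervalIntegral.integral_add_adjacent_intervals
    (Continuous.intervalIntegrable (by fun_prop) _ _)
    (Continuous.intervalIntegrable (by fun_prop) _ _)]
  exact integral_beta_mean_one_le p q hm hm2

theorem regIncBeta_eq (p q : ℕ) (x : ℝ) :
    regIncBeta x ((p : ℝ) + 1) ((q : ℝ) + 1) =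
      (∫ t in (0 : ℝ)..x, t ^ p * (1 - t) ^ q) / ∫ t in (0 : ℝ)..1, t ^ p * (1 - t) ^ q := by
  have hB : ProbabilityTheory.beta ((p : ℝ) + 1) ((q : ℝ) + 1) =
      ∫ t in (0 : ℝ)..1, t ^ p * (1 - t) ^ q := by
    rw [ProbabilityTheory.beta_eq_betaIntegralReal _ _ (by positivity) (by positivity)]
    have : Complex.betaIntegral (((p : ℝ) + 1 : ℝ) : ℂ) (((q : ℝ) + 1 : ℝ) : ℂ) =
        ((∫ t in (0 : ℝ)..1, t ^ p * (1 - t) ^ q : ℝ) : ℂ) := by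
      rw [Complex.betaIntegral, ← intervalIntegral.integral_ofReal]
      simp
    rw [this, Complex.ofReal_re]
  rw [regIncBeta, hB]
  simp

theorem integral_beta_pos (p q : ℕ) {a b : ℝ} (ha : 0 ≤ a) (hab : a < b) (hb : b ≤ 1) :
    0 < ∫ t in a..b, t ^ p * (1 - t) ^ q := by
  refine intervalIntegral.intervalIntegral_pos_of_pos_on
    (Continuous.intervalIntegrable (by fun_prop) _ _) (fun t ht => ?_) hab
  have h1 : 0 < t := by linarith [ht.1]
  have h2 : 0 < 1 - t := by linarith [ht.2]
  positivity

theorem regIncBeta_half_sub_mean_lt (p q : ℕ) {m : ℝ} (hm : m * (p + q + 2) = p + 1) :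
    regIncBeta (1 / 2) ((p : ℝ) + 1) ((q : ℝ) + 1) - regIncBeta m ((p : ℝ) + 1) ((q : ℝ) + 1)
      < 1 / 2 := by
  have hii : ∀ a b : ℝ, IntervalIntegrable (fun t : ℝ => t ^ p * (1 - t) ^ q) volume a b :=
    fun a b => Continuous.intervalIntegrable (by fun_prop) a b
  rw [regIncBeta_eq, regIncBeta_eq, ← sub_div,
    intervalIntegral.integral_interval_sub_left (hii _ _) (hii _ _),
    div_lt_iff₀ (integral_beta_pos p q le_rfl one_pos le_rfl)]
  have hmN : m * ((q : ℝ) + 1) = (1 - m) * (p + 1) := by linarith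
  have hq : (0 : ℝ) < q + 1 := by positivity
  have hp : (0 : ℝ) < p + 1 := by positivity
  have hm1 : m ≤ 1 := by
    by_contra! h
    nlinarith
  rcases le_or_gt m (1 / 2) with hm2 | hm2
  · have hm0 : 0 ≤ m := by
      by_contra! h
      nlinarith
    have h1 := integral_beta_mean_half_le p q hm hm2
    have h2 := integral_beta_pos p q (a := 1 / 2) (b := 1) (by norm_num) (by norm_num) le_rfl
    have h3 := intervalIntegral.integral_add_adjacent_intervals (hii 0 m) (hii m 1)
    have h4 := intervalIntegral.integral_add_adjacent_intervals (hii m (1 / 2)) (hii (1 / 2) 1)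
    linarith
  · have h1 := integral_beta_pos p q (a := 1 / 2) (by norm_num) hm2 hm1
    have h2 := integral_beta_pos p q le_rfl one_pos le_rfl
    rw [intervalIntegral.integral_symm]
    linarith

/-! ### The ratio of the norms of two Gaussian vectors -/

section RatioLaw

variable {E F : Type*} [NormedAddCommGroup E] [NormedSpace ℝ E] [FiniteDimensional ℝ E]
  [MeasurableSpace E] [BorelSpace E] [NormedAddCommGroup F] [NormedSpace ℝ F]
  [FiniteDimensional ℝ F] [MeasurableSpace F] [BorelSpace F]

theorem lintegral_eq_mul_lintegral_comp_smul (μ : Measure E) [μ.IsAddHaarMeasure]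
    {g : E → ℝ≥0∞} (hg : Measurable g) {c : ℝ} (hc : 0 < c) :
    ∫⁻ x, g x ∂μ = ENNReal.ofReal (c ^ Module.finrank ℝ E) * ∫⁻ x, g (c • x) ∂μ := by
  have h := lintegral_map (μ := μ) hg (measurable_const_smul c)
  rw [Measure.map_addHaar_smul μ hc.ne', lintegral_smul_measure, smul_eq_mul] at h
  rw [← h, ← mul_assoc, ← ENNReal.ofReal_mul (by positivity), abs_of_pos (by positivity),
    mul_inv_cancel₀ (by positivity), ENNReal.ofReal_one, one_mul]

/-- For a Gaussian pair `(x, y)` the law of `‖x‖ / ‖y‖` is, up to a constant, that of `‖x‖` under the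
density `(1 + ‖x‖ ^ 2) ^ (-(r + s))`: rescale `x` by `‖y‖`, exchange the integrals, and rescale `y`
by `(1 + ‖x‖ ^ 2) ^ (-1 / 2)`. -/
theorem lintegral_gaussian_ratio (μ : Measure E) (ν : Measure F) [μ.IsAddHaarMeasure]
    [ν.IsAddHaarMeasure] [Nontrivial F] {r s : ℕ} (hE : Module.finrank ℝ E = 2 * r)
    (hF : Module.finrank ℝ F = 2 * s) {T : Set ℝ} (hT : MeasurableSet T) :
    ∫⁻ z : E × F, T.indicator 1 (‖z.1‖ / ‖z.2‖) *
        ENNReal.ofReal (Real.exp (-(‖z.1‖ ^ 2 + ‖z.2‖ ^ 2))) ∂(μ.prod ν) =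
      (∫⁻ y, ENNReal.ofReal (‖y‖ ^ (2 * r) * Real.exp (-‖y‖ ^ 2)) ∂ν) *
        ∫⁻ x, T.indicator 1 ‖x‖ * ENNReal.ofReal (((1 + ‖x‖ ^ 2) ^ (r + s))⁻¹) ∂μ := by
  have hind : Measurable (T.indicator (1 : ℝ → ℝ≥0∞)) := measurable_one.indicator hT
  have step1 : ∀ᵐ y ∂ν, (∫⁻ x, T.indicator 1 (‖x‖ / ‖y‖) *
        ENNReal.ofReal (Real.exp (-(‖x‖ ^ 2 + ‖y‖ ^ 2))) ∂μ) =
      ∫⁻ x, T.indicator 1 ‖x‖ * ENNReal.ofReal (‖y‖ ^ (2 * r) *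
        Real.exp (-((1 + ‖x‖ ^ 2) * ‖y‖ ^ 2))) ∂μ := by
    have h0 : ∀ᵐ y ∂ν, y ≠ 0 := by
      simp [ae_iff]
    filter_upwards [h0] with y hy
    have hy : 0 < ‖y‖ := norm_pos_iff.2 hy
    rw [lintegral_eq_mul_lintegral_comp_smul μ (by fun_prop) hy, hE,
      ← lintegral_const_mul _ (by fun_prop)]
    refine lintegral_congr fun x => ?_
    rw [norm_smul, Real.norm_of_nonneg hy.le, mul_div_cancel_left₀ _ hy.ne', mul_left_comm,
      ← ENNReal.ofReal_mul (by positivity)]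
    congr 5
    ring
  have step2 : ∀ x : E, (∫⁻ y, ENNReal.ofReal (‖y‖ ^ (2 * r) *
        Real.exp (-((1 + ‖x‖ ^ 2) * ‖y‖ ^ 2))) ∂ν) =
      ENNReal.ofReal (((1 + ‖x‖ ^ 2) ^ (r + s))⁻¹) *
        ∫⁻ y, ENNReal.ofReal (‖y‖ ^ (2 * r) * Real.exp (-‖y‖ ^ 2)) ∂ν := by
    intro x
    set k : ℝ := 1 + ‖x‖ ^ 2
    have hk : 0 < k := by positivity
    rw [lintegral_eq_mul_lintegral_comp_smul ν (by fun_prop) (c := (√k)⁻¹) (by positivity), hF,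
      ← lintegral_const_mul _ (by fun_prop), ← lintegral_const_mul _ (by fun_prop)]
    refine lintegral_congr fun y => ?_
    rw [← ENNReal.ofReal_mul (by positivity), ← ENNReal.ofReal_mul (by positivity), norm_smul,
      Real.norm_of_nonneg (by positivity)]
    congr 1
    have h1 : k * ((√k)⁻¹ * ‖y‖) ^ 2 = ‖y‖ ^ 2 := by
      rw [mul_pow, inv_pow, Real.sq_sqrt hk.le]; field_simp
    rw [h1, mul_pow, inv_pow, inv_pow, pow_mul, pow_mul (√k), Real.sq_sqrt hk.le, pow_add]
    field_simp
  rw [lintegral_prod_symm _ (by fun_prop), lintegral_congr_ae step1,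
    lintegral_lintegral_swap (by fun_prop),
    mul_comm (∫⁻ y, ENNReal.ofReal (‖y‖ ^ (2 * r) * Real.exp (-‖y‖ ^ 2)) ∂ν),
    ← lintegral_mul_const _ (by fun_prop)]
  refine lintegral_congr fun x => ?_
  rw [lintegral_const_mul _ (by fun_prop), step2, mul_assoc]

/-- The substitution `t = u ^ 2 / (1 + u ^ 2)` in polar coordinates turns the radial density
`(1 + u ^ 2) ^ (-(p + q + 2))` into a beta density. The set `T` of admissible norms need only agree
with the interval from `a` to `b` up to a null set of positive reals. -/
theorem lintegral_indicator_norm (μ : Measure E) [μ.IsAddHaarMeasure]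
    {p q : ℕ} (hE : Module.finrank ℝ E = 2 * (p + 1)) {a b : ℝ} (hab : a ≤ b)
    {T : Set ℝ} (hT : MeasurableSet T) (hsub : Ioi 0 ∩ T ⊆ Icc a b)
    (hTab : (Ioi 0 ∩ T : Set ℝ) =ᵐ[volume] Ioc a b) :
    ∫⁻ x, T.indicator 1 ‖x‖ *
        ENNReal.ofReal (((1 + ‖x‖ ^ 2) ^ ((p + 1) + (q + 1)))⁻¹) ∂μ =
      ENNReal.ofReal ((p + 1) * μ.real (Metric.ball 0 1) *
        ∫ t in (a ^ 2 / (1 + a ^ 2))..(b ^ 2 / (1 + b ^ 2)), t ^ p * (1 - t) ^ q) := by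
  have : Nontrivial E := (Module.finrank_pos_iff (R := ℝ) (M := E)).1 (by omega)
  let w : ℝ → ℝ := fun y => ((1 + y ^ 2) ^ ((p + 1) + (q + 1)))⁻¹
  have hw : Continuous w := by
    refine Continuous.inv₀ (by fun_prop) fun y => by positivity
  have hw0 : ∀ y, 0 ≤ w y := fun y => by positivity
  let f : ℝ → ℝ := T.indicator w
  have hf0 : ∀ y, 0 ≤ f y := fun y => indicator_nonneg (fun _ _ => hw0 _) y
  have hmul : (fun y : ℝ => y ^ (2 * (p + 1) - 1) • f y) =
      T.indicator fun y => y ^ (2 * (p + 1) - 1) * w y := by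
    ext y
    by_cases hy : y ∈ T <;> simp [f, hy]
  have hint : Integrable (fun x : E => f ‖x‖) μ := by
    rw [integrable_fun_norm_addHaar μ (f := f), hE, hmul, IntegrableOn,
      integrable_indicator_iff hT, IntegrableOn, Measure.restrict_restrict hT, inter_comm]
    exact (Continuous.integrableOn_Icc (by fun_prop)).mono_set hsub
  have hlhs : ∀ x : E, T.indicator 1 ‖x‖ *
      ENNReal.ofReal (((1 + ‖x‖ ^ 2) ^ ((p + 1) + (q + 1)))⁻¹) = ENNReal.ofReal (f ‖x‖) := by
    intro x
    by_cases hy : ‖x‖ ∈ T <;> simp [f, hy, w]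
  rw [lintegral_congr hlhs, ← ofReal_integral_eq_lintegral_ofReal hint (ae_of_all _ fun x => hf0 _),
    integral_fun_norm_addHaar μ f, hE, hmul, setIntegral_indicator hT,
    setIntegral_congr_set hTab, ← intervalIntegral.integral_of_le hab]
  have hφ : ∀ y : ℝ, HasDerivAt (fun y : ℝ => y ^ 2 / (1 + y ^ 2)) (2 * y / (1 + y ^ 2) ^ 2) y := by
    intro y
    have h1 : HasDerivAt (fun y : ℝ => y ^ 2) (2 * y) y := by simpa using hasDerivAt_pow 2 y
    refine (h1.div (h1.const_add 1) (by positivity)).congr_deriv ?_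
    field_simp
    ring
  have hsubst := intervalIntegral.integral_comp_mul_deriv (a := a) (b := b)
    (g := fun t : ℝ => t ^ p * (1 - t) ^ q) (fun y _ => hφ y)
    (Continuous.continuousOn (Continuous.div (by fun_prop) (by fun_prop) fun y => by positivity))
    (by fun_prop)
  rw [← hsubst]
  congr 1
  rw [nsmul_eq_mul, smul_eq_mul, ← mul_assoc, ← intervalIntegral.integral_const_mul,
    ← intervalIntegral.integral_const_mul]
  refine intervalIntegral.integral_congr fun y _ => ?_
  have h1 : 1 - y ^ 2 / (1 + y ^ 2) = (1 + y ^ 2)⁻¹ := by field_simp; ring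
  have h2 : 2 * (p + 1) - 1 = 2 * p + 1 := by omega
  simp only [Function.comp_apply, h1, h2, w]
  rw [div_pow, inv_pow]
  push_cast
  field_simp
  ring

/-- Here `a` is the ratio at which `‖x‖ ^ 2 / (‖x‖ ^ 2 + ‖y‖ ^ 2)` equals its mean, and the ratio `1`
corresponds to the value `1 / 2`. -/
theorem lintegral_gaussian_ratio_Icc_le (μ : Measure E) (ν : Measure F) [μ.IsAddHaarMeasure]
    [ν.IsAddHaarMeasure] {p q : ℕ} (hE : Module.finrank ℝ E = 2 * (p + 1))
    (hF : Module.finrank ℝ F = 2 * (q + 1)) {a : ℝ} (ha : 0 ≤ a) (ha1 : a ≤ 1)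
    (hm : (q + 1) * a ^ 2 = p + 1) :
    ∫⁻ z : E × F, (Icc a 1).indicator 1 (‖z.1‖ / ‖z.2‖) *
        ENNReal.ofReal (Real.exp (-(‖z.1‖ ^ 2 + ‖z.2‖ ^ 2))) ∂(μ.prod ν) ≤
      ∫⁻ z : E × F, (Iio a).indicator 1 (‖z.1‖ / ‖z.2‖) *
        ENNReal.ofReal (Real.exp (-(‖z.1‖ ^ 2 + ‖z.2‖ ^ 2))) ∂(μ.prod ν) := by
  have hq : (0 : ℝ) < q + 1 := by positivity
  have hp : (0 : ℝ) < p + 1 := by positivity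
  have : Nontrivial F := (Module.finrank_pos_iff (R := ℝ) (M := F)).1 (by omega)
  have ha0 : 0 < a := ha.lt_of_ne fun h => by rw [← h] at hm; norm_num at hm; linarith
  rw [lintegral_gaussian_ratio μ ν hE hF measurableSet_Icc,
    lintegral_gaussian_ratio μ ν hE hF measurableSet_Iio]
  gcongr 1
  have hset : Ioi 0 ∩ Icc a 1 = Icc a 1 := inter_eq_right.2 fun x hx => ha0.trans_le hx.1
  rw [lintegral_indicator_norm μ hE ha1 measurableSet_Icc inter_subset_right
      (hset.symm ▸ Ioc_ae_eq_Icc.symm),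
    lintegral_indicator_norm μ hE ha measurableSet_Iio
      (by rw [Ioi_inter_Iio]; exact Ioo_subset_Icc_self)
      (by rw [Ioi_inter_Iio]; exact Ioo_ae_eq_Ioc)]
  have h1 : (0 : ℝ) ^ 2 / (1 + 0 ^ 2) = 0 := by norm_num
  have h2 : (1 : ℝ) ^ 2 / (1 + 1 ^ 2) = 1 / 2 := by norm_num
  rw [h1, h2]
  have hmean : a ^ 2 / (1 + a ^ 2) * (p + q + 2) = p + 1 := by
    field_simp
    linarith
  have hhalf : a ^ 2 / (1 + a ^ 2) ≤ 1 / 2 := by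
    rw [div_le_div_iff₀ (by positivity) two_pos]
    nlinarith
  have h3 := integral_beta_mean_half_le p q hmean hhalf
  have h4 := integral_beta_pos p q (a := 1 / 2) (b := 1) (by norm_num) (by norm_num) le_rfl
  gcongr
  linarith

end RatioLaw

/-! ### Projectors, contexts and decompositions -/

section Projectors

variable {d : ℕ}

theorem IsStarProjection.re_inner_apply_self {P : QOp d} (hP : IsStarProjection P) (φ : QSpace d) :
    RCLike.re (inner ℂ φ (P φ)) = ‖P φ‖ ^ 2 := by
  have h1 : P (P φ) = P φ := by
    have := congrArg (fun T : QOp d => T φ) hP.isIdempotentElem.eq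
    simpa using this
  have h2 : inner ℂ (P φ) (P φ) = inner ℂ φ (P φ) := by
    have := ContinuousLinearMap.adjoint_inner_left P (P φ) φ
    rw [← ContinuousLinearMap.star_eq_adjoint, hP.isSelfAdjoint.star_eq, h1] at this
    exact this
  rw [← h2, inner_self_eq_norm_sq]

theorem IsStarProjection.norm_sq_add {P : QOp d} (hP : IsStarProjection P) (φ : QSpace d) :
    ‖P φ‖ ^ 2 + ‖φ - P φ‖ ^ 2 = ‖φ‖ ^ 2 := by
  have := hP.re_inner_apply_self φ
  rw [@norm_sub_sq ℂ, this]
  ring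

theorem norm_sq_add_le_of_mul_eq_zero {P Q : QOp d} (hP : IsStarProjection P)
    (hQ : IsStarProjection Q) (h : P * Q = 0) (φ : QSpace d) :
    ‖P φ‖ ^ 2 + ‖Q φ‖ ^ 2 ≤ ‖φ‖ ^ 2 := by
  have hPQ : IsStarProjection (P + Q) := hP.add hQ h
  have h1 := hPQ.re_inner_apply_self φ
  have h2 := hPQ.norm_sq_add φ
  rw [add_apply, inner_add_right, map_add, hP.re_inner_apply_self,
    hQ.re_inner_apply_self] at h1
  rw [h1]
  rw [add_apply] at h2
  nlinarith [sq_nonneg ‖φ - (P φ + Q φ)‖]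

theorem IsRankProjector.trace_eq {r : ℕ} {P : QOp d} (hP : IsRankProjector r P) :
    LinearMap.trace ℂ (QSpace d) (P : QSpace d →ₗ[ℂ] QSpace d) = r := by
  have h : IsIdempotentElem (P : QSpace d →ₗ[ℂ] QSpace d) := by
    have := hP.1.isIdempotentElem.eq
    exact LinearMap.ext fun x => by simpa using congrArg (fun T : QOp d => T x) this
  rw [(LinearMap.IsIdempotentElem.isProj_range _ h).trace, hP.2]

/-- Taking traces, a context of rank `r` projectors has `d / r` members, and the numbers `‖P φ‖ ^ 2`
add up to `‖φ‖ ^ 2`; so one of them is at least the average. -/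
theorem exists_mem_context_le {r : ℕ} (hd : 0 < d) {S : Set (QOp d)}
    (hS : ∀ P ∈ S, IsRankProjector r P) {c : Finset (QOp d)} (hc : IsContext S c) (φ : QSpace d) :
    ∃ P ∈ c, r * ‖φ‖ ^ 2 ≤ d * ‖P φ‖ ^ 2 := by
  by_contra! hlt
  have hcard : (c.card : ℝ) * r = d := by
    have h := congrArg
      (fun T : QOp d => LinearMap.trace ℂ (QSpace d) (T : QSpace d →ₗ[ℂ] QSpace d)) hc.2
    have h1 : ((∑ P ∈ c, P : QOp d) : QSpace d →ₗ[ℂ] QSpace d) =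
        ∑ P ∈ c, (P : QSpace d →ₗ[ℂ] QSpace d) := by
      ext x; simp
    have h2 : ((1 : QOp d) : QSpace d →ₗ[ℂ] QSpace d) = 1 := rfl
    simp only [h1, h2, map_sum, LinearMap.trace_one, finrank_euclideanSpace_fin] at h
    rw [Finset.sum_congr rfl fun P hP => (hS P (hc.1 P hP)).trace_eq, Finset.sum_const,
      nsmul_eq_mul] at h
    exact_mod_cast h
  have hsum : ∑ P ∈ c, ‖P φ‖ ^ 2 = ‖φ‖ ^ 2 := by
    have h := congrArg (fun T : QOp d => RCLike.re (inner ℂ φ (T φ))) hc.2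
    simp only [sum_apply, inner_sum, map_sum, one_apply_eq_self,
      inner_self_eq_norm_sq] at h
    rw [← h]
    exact Finset.sum_congr rfl fun P hP => ((hS P (hc.1 P hP)).1.re_inner_apply_self φ).symm
  have hne : c.Nonempty := by
    rw [Finset.nonempty_iff_ne_empty]
    rintro rfl
    simp only [Finset.card_empty, Nat.cast_zero, zero_mul] at hcard
    exact hd.ne (by exact_mod_cast hcard)
  have := Finset.sum_lt_sum_of_nonempty hne hlt
  rw [← Finset.mul_sum, hsum, Finset.sum_const, nsmul_eq_mul, ← mul_assoc, hcard] at this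
  exact lt_irrefl _ this

end Projectors

section Decompositions

variable {d n : ℕ} {P : QOp d} {ψ : Fin n → QSpace d}

theorem IsDecomposition.norm_sq_apply (h : IsDecomposition P ψ) (φ : QSpace d) :
    ‖P φ‖ ^ 2 = ∑ i, ‖rankOne ℂ (ψ i) (ψ i) φ‖ ^ 2 := by
  rw [h.2]
  simp only [sum_apply, rankOne_apply]
  rw [← inner_self_eq_norm_sq (𝕜 := ℂ), h.1.inner_sum, map_sum]
  refine Finset.sum_congr rfl fun i _ => ?_
  rw [norm_smul, h.1.norm_eq_one i, mul_one, RCLike.conj_mul]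
  norm_cast

theorem IsDecomposition.card_eq {r : ℕ} (h : IsDecomposition P ψ) (hP : IsRankProjector r P) :
    n = r := by
  have h1 := hP.trace_eq
  have h2 : ((∑ i, rankOne ℂ (ψ i) (ψ i) : QOp d) : QSpace d →ₗ[ℂ] QSpace d) =
      ∑ i, ((rankOne ℂ (ψ i) (ψ i) : QOp d) : QSpace d →ₗ[ℂ] QSpace d) := by
    ext x; simp
  rw [h.2, h2, map_sum] at h1
  simp only [trace_rankOne, inner_self_eq_norm_sq_to_K, h.1.norm_eq_one] at h1
  simp at h1
  exact_mod_cast h1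

theorem IsRankProjector.isDecomposition_orthonormalBasis {r : ℕ} (hP : IsRankProjector r P)
    (b : OrthonormalBasis (Fin n) ℂ (P : QSpace d →ₗ[ℂ] QSpace d).range) :
    IsDecomposition P fun i => (b i : QSpace d) := by
  refine ⟨b.orthonormal.comp_linearIsometry (Submodule.subtypeₗᵢ _), ?_⟩
  rw [← b.starProjection_eq_sum_rankOne]
  obtain ⟨_, h⟩ := isStarProjection_iff_eq_starProjection_range.1 hP.1
  exact h

end Decompositions

/-- Every vector is a nonnegative multiple of the first vector of some orthonormal basis. -/
theorem exists_orthonormalBasis_zero_eq {E : Type*} [NormedAddCommGroup E] [InnerProductSpace ℂ E]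
    [FiniteDimensional ℂ E] {n : ℕ} (hn : Module.finrank ℂ E = n + 1) (v : E) :
    ∃ b : OrthonormalBasis (Fin (n + 1)) ℂ E, v = (‖v‖ : ℂ) • b 0 := by
  by_cases hv : v = 0
  · exact ⟨(stdOrthonormalBasis ℂ E).reindex (finCongr hn), by simp [hv]⟩
  · have hv' : (‖v‖ : ℂ) ≠ 0 := by simpa using hv
    have ho : Orthonormal ℂ (({0} : Set (Fin (n + 1))).domRestrict fun _ => (‖v‖ : ℂ)⁻¹ • v) := by
      refine ⟨fun i => by simp [norm_smul, hv], fun i j hij => ?_⟩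
      exact absurd (Subsingleton.elim i j) hij
    obtain ⟨b, hb⟩ := ho.exists_orthonormalBasis_extension_of_card_eq (by simpa using hn)
    refine ⟨b, ?_⟩
    rw [hb 0 rfl, smul_inv_smul₀ hv']

/-- Every vector has equal overlaps with all members of some orthonormal basis: move it by a unitary
onto a multiple of the all-ones vector `u`. -/
theorem exists_orthonormalBasis_norm_inner_sq_eq {E : Type*} [NormedAddCommGroup E]
    [InnerProductSpace ℂ E] [FiniteDimensional ℂ E] {n : ℕ} (hn : Module.finrank ℂ E = n + 1)
    (v : E) : ∃ b : OrthonormalBasis (Fin (n + 1)) ℂ E,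
      ∀ i, (n + 1) * ‖inner ℂ (b i) v‖ ^ 2 = ‖v‖ ^ 2 := by
  obtain ⟨b, hb⟩ := exists_orthonormalBasis_zero_eq hn v
  let u : EuclideanSpace ℂ (Fin (n + 1)) := WithLp.toLp 2 fun _ => 1
  have hu : ‖u‖ ^ 2 = n + 1 := by simp [EuclideanSpace.norm_sq_eq, u]
  obtain ⟨c, hc⟩ := exists_orthonormalBasis_zero_eq (n := n) (by simp) u
  let L := b.repr.trans c.repr.symm
  refine ⟨(EuclideanSpace.basisFun (Fin (n + 1)) ℂ).map L.symm, fun i => ?_⟩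
  have hu0 : (‖u‖ : ℂ) ≠ 0 := by
    intro h
    have : ‖u‖ = 0 := by exact_mod_cast h
    rw [this] at hu
    have : (0 : ℝ) < n + 1 := by positivity
    linarith
  have hL : L v = (‖v‖ / ‖u‖ : ℂ) • u := by
    conv_lhs => rw [hb]
    conv_rhs => rw [hc]
    have : L (b 0) = c 0 := by simp [L]
    rw [map_smul, this, smul_smul]
    congr 1
    rw [← hc]
    field_simp
  have : inner ℂ (((EuclideanSpace.basisFun (Fin (n + 1)) ℂ).map L.symm) i) v = ‖v‖ / ‖u‖ := by
    rw [OrthonormalBasis.map_apply, LinearIsometryEquiv.inner_map_eq_flip]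
    rw [LinearIsometryEquiv.symm_symm, hL, inner_smul_right]
    simp [u, EuclideanSpace.inner_single_left]
  rw [this, norm_div, div_pow]
  simp only [Complex.norm_real, norm_norm]
  rw [← hu]
  have : ‖u‖ ≠ 0 := by exact_mod_cast hu0
  field_simp

/-! ### The valuation defined by a pure state -/

section Valuation

variable {d : ℕ}

open Classical in
/-- The valuation of projectors defined by a pure state `φ`, not necessarily normalised: with
`p = ‖P φ‖ ^ 2 / ‖φ‖ ^ 2` the outcome probability, it is `0` if `p < 1 / d`, it is `1` if `p > 1 / 2`,
and `C` otherwise. The zero vector gives the constant valuation `C`. -/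
noncomputable def overlapValuation (φ : QSpace d) (P : QOp d) : Valuation01C :=
  if d * ‖P φ‖ ^ 2 < ‖φ‖ ^ 2 then Valuation01C.zero
  else if ‖φ‖ ^ 2 < 2 * ‖P φ‖ ^ 2 then Valuation01C.one
  else Valuation01C.contextual

theorem overlapValuation_eq_zero_iff {φ : QSpace d} {P : QOp d} :
    overlapValuation φ P = Valuation01C.zero ↔ d * ‖P φ‖ ^ 2 < ‖φ‖ ^ 2 := by
  unfold overlapValuation
  split_ifs <;> simp_all

theorem lt_of_overlapValuation_eq_one {φ : QSpace d} {P : QOp d}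
    (h : overlapValuation φ P = Valuation01C.one) : ‖φ‖ ^ 2 < 2 * ‖P φ‖ ^ 2 := by
  unfold overlapValuation at h
  split_ifs at h with h1 h2
  exact h2

theorem overlapValuation_eq_one (hd : 2 ≤ d) {φ : QSpace d} {P : QOp d}
    (h : ‖φ‖ ^ 2 < 2 * ‖P φ‖ ^ 2) : overlapValuation φ P = Valuation01C.one := by
  have hd' : (2 : ℝ) ≤ d := by exact_mod_cast hd
  have : 2 * ‖P φ‖ ^ 2 ≤ d * ‖P φ‖ ^ 2 := by gcongr
  rw [overlapValuation, if_neg (by linarith), if_pos h]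

theorem isAdmissible_overlapValuation (hd : 0 < d) (φ : QSpace d) :
    IsAdmissible (rankOneProjectors d) (overlapValuation φ) where
  exists_ne_zero c hc := by
    obtain ⟨P, hPc, hP⟩ := exists_mem_context_le hd (r := 1) (fun P hP => hP) hc φ
    refine ⟨P, hPc, fun h => ?_⟩
    rw [overlapValuation_eq_zero_iff] at h
    rw [Nat.cast_one, one_mul] at hP
    linarith
  not_both_one P hP Q hQ hPQ h := by
    have h1 := lt_of_overlapValuation_eq_one h.1
    have h2 := lt_of_overlapValuation_eq_one h.2
    have h3 := norm_sq_add_le_of_mul_eq_zero hP.1 hQ.1 hPQ φ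
    linarith

theorem lt_of_inheritedValuation_eq_zero {r : ℕ} (hr : 0 < r) {φ : QSpace d} {P : QOp d}
    (hP : IsRankProjector r P)
    (h : inheritedValuation (overlapValuation φ) P = Valuation01C.zero) :
    d * ‖P φ‖ ^ 2 < r * ‖φ‖ ^ 2 := by
  unfold inheritedValuation at h
  split_ifs at h with h1
  obtain ⟨n, ψ, hψ, hz⟩ := h1
  obtain rfl := hψ.card_eq hP
  have : Nonempty (Fin n) := ⟨⟨0, hr⟩⟩
  have := Finset.sum_lt_sum_of_nonempty Finset.univ_nonempty
    fun i (_ : i ∈ Finset.univ) => overlapValuation_eq_zero_iff.1 (hz i)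
  rw [← Finset.mul_sum, ← hψ.norm_sq_apply] at this
  simpa using this

theorem lt_of_inheritedValuation_eq_one {φ : QSpace d} {P : QOp d}
    (h : inheritedValuation (overlapValuation φ) P = Valuation01C.one) :
    ‖φ‖ ^ 2 < 2 * ‖P φ‖ ^ 2 := by
  unfold inheritedValuation at h
  split_ifs at h with h1 h2
  obtain ⟨n, ψ, hψ, hz⟩ := h2
  obtain ⟨i, hi⟩ : ∃ i, overlapValuation φ (rankOne ℂ (ψ i) (ψ i)) = Valuation01C.one := by
    by_contra! hne
    exact h1 ⟨n, ψ, hψ, fun i => (hz i).resolve_right (hne i)⟩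
  have h3 := lt_of_overlapValuation_eq_one hi
  have h4 : ‖rankOne ℂ (ψ i) (ψ i) φ‖ ^ 2 ≤ ‖P φ‖ ^ 2 := by
    rw [hψ.norm_sq_apply]
    exact Finset.single_le_sum (f := fun i => ‖rankOne ℂ (ψ i) (ψ i) φ‖ ^ 2)
      (fun _ _ => sq_nonneg _) (Finset.mem_univ i)
  linarith

theorem isAdmissible_inheritedValuation {r : ℕ} (hr : 0 < r) (hd : 0 < d) {S : Set (QOp d)}
    (hS : ∀ P ∈ S, IsRankProjector r P) (φ : QSpace d) :
    IsAdmissible S (inheritedValuation (overlapValuation φ)) where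
  exists_ne_zero c hc := by
    obtain ⟨P, hPc, hP⟩ := exists_mem_context_le hd hS hc φ
    refine ⟨P, hPc, fun h => ?_⟩
    exact hP.not_gt (lt_of_inheritedValuation_eq_zero hr (hS P (hc.1 P hPc)) h)
  not_both_one P hP Q hQ hPQ h := by
    have h1 := lt_of_inheritedValuation_eq_one h.1
    have h2 := lt_of_inheritedValuation_eq_one h.2
    have h3 := norm_sq_add_le_of_mul_eq_zero (hS P hP).1 (hS Q hQ).1 hPQ φ
    linarith

/-- For a unit vector `x` in the range of `P`, the overlap of `x` with `φ` is its overlap with `P φ`. -/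
theorem IsStarProjection.norm_rankOne_apply {P : QOp d} (hP : IsStarProjection P)
    {x v : (P : QSpace d →ₗ[ℂ] QSpace d).range} (hx : ‖x‖ = 1) {φ : QSpace d}
    (hv : (v : QSpace d) = P φ) :
    ‖rankOne ℂ (x : QSpace d) (x : QSpace d) φ‖ = ‖inner ℂ x v‖ := by
  have h1 : P x = x := by
    obtain ⟨_, y, rfl⟩ := x
    have := congrArg (fun T : QOp d => T y) hP.isIdempotentElem.eq
    simpa using this
  have h2 : inner ℂ (x : QSpace d) φ = inner ℂ (x : QSpace d) (P φ) := by
    have := ContinuousLinearMap.adjoint_inner_left P φ x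
    rwa [← ContinuousLinearMap.star_eq_adjoint, hP.isSelfAdjoint.star_eq, h1] at this
  rw [rankOne_apply, norm_smul, ← Submodule.coe_norm, hx, mul_one, h2, Submodule.coe_inner, hv]

/-- Decompose `P` along an orthonormal basis of its range on which the weight of `P φ` is spread
evenly. -/
theorem inheritedValuation_eq_zero {r : ℕ} (hr : 0 < r) {φ : QSpace d} {P : QOp d}
    (hP : IsRankProjector r P) (h : d * ‖P φ‖ ^ 2 < r * ‖φ‖ ^ 2) :
    inheritedValuation (overlapValuation φ) P = Valuation01C.zero := by
  obtain ⟨p, rfl⟩ := Nat.exists_eq_succ_of_ne_zero hr.ne'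
  obtain ⟨v, hv⟩ : ∃ v : (P : QSpace d →ₗ[ℂ] QSpace d).range, (v : QSpace d) = P φ :=
    ⟨⟨P φ, LinearMap.mem_range_self _ φ⟩, rfl⟩
  obtain ⟨b, hb⟩ := exists_orthonormalBasis_norm_inner_sq_eq hP.2 v
  refine if_pos ⟨_, _, hP.isDecomposition_orthonormalBasis b, fun i => ?_⟩
  rw [overlapValuation_eq_zero_iff, hP.1.norm_rankOne_apply (b.norm_eq_one i) hv]
  have h1 := hb i
  rw [Submodule.coe_norm, hv] at h1
  rw [← h1] at h
  push_cast at h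
  have hp : (0 : ℝ) < p + 1 := by positivity
  refine lt_of_mul_lt_mul_left (a := (p : ℝ) + 1) ?_ hp.le
  linarith

/-- Decompose `P` along an orthonormal basis of its range whose first vector is proportional to `P φ`;
the other vectors are then orthogonal to `φ`. -/
theorem inheritedValuation_ne_contextual {r : ℕ} (hr : 0 < r) (hd : 2 ≤ d) {φ : QSpace d}
    {P : QOp d} (hP : IsRankProjector r P) (h : ‖φ‖ ^ 2 < 2 * ‖P φ‖ ^ 2) :
    inheritedValuation (overlapValuation φ) P ≠ Valuation01C.contextual := by
  obtain ⟨p, rfl⟩ := Nat.exists_eq_succ_of_ne_zero hr.ne'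
  obtain ⟨v, hv⟩ : ∃ v : (P : QSpace d →ₗ[ℂ] QSpace d).range, (v : QSpace d) = P φ :=
    ⟨⟨P φ, LinearMap.mem_range_self _ φ⟩, rfl⟩
  obtain ⟨b, hb⟩ := exists_orthonormalBasis_zero_eq hP.2 v
  have hvn : ‖v‖ = ‖P φ‖ := by rw [Submodule.coe_norm, hv]
  have hφ : 0 < ‖φ‖ ^ 2 := by
    have := hP.1.norm_sq_add φ
    nlinarith [sq_nonneg ‖φ - P φ‖, sq_nonneg ‖φ‖]
  unfold inheritedValuation
  split_ifs with h1 h2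
  · simp
  · simp
  · refine absurd ⟨_, _, hP.isDecomposition_orthonormalBasis b, fun i => ?_⟩ h2
    have hn := hP.1.norm_rankOne_apply (b.norm_eq_one i) hv
    rw [hb, inner_smul_right, b.inner_eq_ite] at hn
    by_cases hi : i = 0
    · right
      refine overlapValuation_eq_one hd ?_
      rw [hn, if_pos hi]
      simpa [hvn] using h
    · left
      rw [overlapValuation_eq_zero_iff, hn, if_neg hi]
      simpa using hφ

theorem bounds_of_inheritedValuation_eq_contextual {r : ℕ} (hr : 0 < r) (hd : 2 ≤ d)
    {φ : QSpace d} {P : QOp d} (hP : IsRankProjector r P)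
    (h : inheritedValuation (overlapValuation φ) P = Valuation01C.contextual) :
    r * ‖φ‖ ^ 2 ≤ d * ‖P φ‖ ^ 2 ∧ 2 * ‖P φ‖ ^ 2 ≤ ‖φ‖ ^ 2 := by
  constructor
  · by_contra! hlt
    rw [inheritedValuation_eq_zero hr hP hlt] at h
    cases h
  · by_contra! hlt
    exact inheritedValuation_ne_contextual hr hd hP hlt h

end Valuation

/-! ### The Gaussian weight of the contextual states -/

section GaussianMeasure

/-- The unnormalised Gaussian measure on `ℂ ^ d`, with density `exp (-‖z‖ ^ 2)`. Its directional part
is the uniform distribution of pure states. -/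
noncomputable def gaussianWeight (d : ℕ) : Measure (QSpace d) :=
  (volume : Measure (QSpace d)).withDensity fun z => ENNReal.ofReal (Real.exp (-‖z‖ ^ 2))

instance isFiniteMeasure_gaussianWeight (d : ℕ) : IsFiniteMeasure (gaussianWeight d) := by
  refine isFiniteMeasure_withDensity_ofReal ?_
  have h := (GaussianFourier.integrable_cexp_neg_mul_sq_norm_add (V := QSpace d) (b := 1)
    (by simp) 0 0).norm
  refine Integrable.hasFiniteIntegral (h.congr (ae_of_all _ fun z => ?_))
  simp [Complex.norm_exp, ← Complex.ofReal_pow]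

theorem gaussianWeight_pos_of_isOpen {d : ℕ} {U : Set (QSpace d)} (hU : IsOpen U)
    (hne : U.Nonempty) : 0 < gaussianWeight d U := by
  rw [pos_iff_ne_zero, gaussianWeight, Ne, withDensity_apply_eq_zero (by fun_prop)]
  have : {z : QSpace d | ENNReal.ofReal (Real.exp (-‖z‖ ^ 2)) ≠ 0} = univ := by
    ext z
    simp [Real.exp_pos]
  rw [this, univ_inter]
  exact (hU.measure_pos volume hne).ne'

theorem indicator_one_le_indicator_one {α β : Type*} {s : Set α} {t : Set β} {x : α} {y : β}
    (h : x ∈ s → y ∈ t) : s.indicator (1 : α → ℝ≥0∞) x ≤ t.indicator 1 y := by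
  by_cases hx : x ∈ s
  · simp [hx, h hx]
  · simp [hx]

variable {d r : ℕ} {P : QOp d}

/-- The states `z` for which the outcome probability `‖P z‖ ^ 2 / ‖z‖ ^ 2` lies in
`[r / d, 1 / 2]`, together with `z = 0`. -/
def contextualBand (r : ℕ) (P : QOp d) : Set (QSpace d) :=
  {z | r * ‖z‖ ^ 2 ≤ d * ‖P z‖ ^ 2 ∧ 2 * ‖P z‖ ^ 2 ≤ ‖z‖ ^ 2}

theorem measurableSet_contextualBand (r : ℕ) (P : QOp d) : MeasurableSet (contextualBand r P) := by
  have h1 : MeasurableSet {z : QSpace d | r * ‖z‖ ^ 2 ≤ d * ‖P z‖ ^ 2} :=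
    measurableSet_le (by fun_prop) (by fun_prop)
  have h2 : MeasurableSet {z : QSpace d | 2 * ‖P z‖ ^ 2 ≤ ‖z‖ ^ 2} :=
    measurableSet_le (by fun_prop) (by fun_prop)
  exact h1.inter h2

/-- Along the splitting of the space into the range of `P` and its orthogonal complement the Gaussian
weight is a product, up to a constant factor that occurs on both sides. -/
theorem gaussianWeight_contextual_le (hr : 0 < r) (hrd : 2 * r ≤ d) (hP : IsRankProjector r P) :
    gaussianWeight d (contextualBand r P) ≤
      gaussianWeight d {z | d * ‖P z‖ ^ 2 < r * ‖z‖ ^ 2} := by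
  obtain ⟨p, rfl⟩ := Nat.exists_eq_succ_of_ne_zero hr.ne'
  obtain ⟨q, rfl⟩ : ∃ q, d = p + 1 + (q + 1) := ⟨d - p - 2, by omega⟩
  set K := (P : QSpace (p + 1 + (q + 1)) →ₗ[ℂ] QSpace (p + 1 + (q + 1))).range with hK
  have hK1 : Module.finrank ℝ K = 2 * (p + 1) := by rw [finrank_real_of_complex, hP.2]
  have hK2 : Module.finrank ℝ Kᗮ = 2 * (q + 1) := by
    have := K.finrank_add_finrank_orthogonal
    rw [hP.2, finrank_euclideanSpace_fin] at this
    rw [finrank_real_of_complex]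
    omega
  let e : (K × Kᗮ) ≃L[ℝ] QSpace (p + 1 + (q + 1)) := LinearEquiv.toContinuousLinearEquiv
    ((K.prodEquivOfIsCompl Kᗮ K.isCompl_orthogonal).restrictScalars ℝ)
  have he : ∀ z, e z = z.1 + z.2 := fun z => rfl
  let μ : Measure K := Measure.addHaar
  let ν : Measure Kᗮ := Measure.addHaar
  have hvol : (volume : Measure (QSpace (p + 1 + (q + 1)))) =
      Measure.addHaarScalarFactor volume ((μ.prod ν).map e) • (μ.prod ν).map e :=
    Measure.isAddLeftInvariant_eq_smul _ _
  have hPe : ∀ z, P (e z) = z.1 := by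
    intro z
    obtain ⟨_, hPK⟩ := isStarProjection_iff_eq_starProjection_range.1 hP.1
    rw [hPK, he, map_add, Submodule.starProjection_eq_self_iff.2 z.1.2,
      (Submodule.starProjection_apply_eq_zero_iff K).2 z.2.2, add_zero]
  have hne : ∀ z, ‖e z‖ ^ 2 = ‖z.1‖ ^ 2 + ‖z.2‖ ^ 2 := by
    intro z
    rw [← hP.1.norm_sq_add (e z), hPe, he, add_sub_cancel_left]
    rfl
  have hrep : ∀ T : Set (QSpace (p + 1 + (q + 1))), MeasurableSet T →
      gaussianWeight _ T = Measure.addHaarScalarFactor volume ((μ.prod ν).map e) *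
        ∫⁻ z : K × Kᗮ, T.indicator 1 (e z) *
          ENNReal.ofReal (Real.exp (-(‖z.1‖ ^ 2 + ‖z.2‖ ^ 2))) ∂(μ.prod ν) := by
    intro T hT
    rw [gaussianWeight, withDensity_apply _ hT, ← lintegral_indicator hT]
    conv_lhs => rw [hvol]
    rw [lintegral_smul_measure, lintegral_map (Measurable.indicator (by fun_prop) hT)
      e.continuous.measurable]
    congr 1
    refine lintegral_congr fun z => ?_
    by_cases hz : e z ∈ T <;> simp [hz, hne]
  -- Where `z.2 = 0` the quotient `‖z.1‖ / ‖z.2‖` has the junk value `0`; this is a null set.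
  have hz2 : ∀ᵐ z ∂(μ.prod ν), z.2 ≠ 0 := by
    have : Nontrivial Kᗮ := (Module.finrank_pos_iff (R := ℝ) (M := Kᗮ)).1 (by omega)
    refine Measure.quasiMeasurePreserving_snd.ae (p := fun y => y ≠ 0) ?_
    simp [ae_iff]
  have hp : (0 : ℝ) < p + 1 := by positivity
  have hq : (0 : ℝ) < q + 1 := by positivity
  have hpq : (p : ℝ) + 1 ≤ q + 1 := by exact_mod_cast (by omega : p + 1 ≤ q + 1)
  set a : ℝ := √((p + 1) / (q + 1)) with ha
  have ha2 : (q + 1) * a ^ 2 = p + 1 := by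
    rw [ha, Real.sq_sqrt (by positivity)]; field_simp
  have ha0 : 0 ≤ a := Real.sqrt_nonneg _
  have ha1 : a ≤ 1 := Real.sqrt_le_one.2 ((div_le_one hq).2 hpq)
  rw [hrep _ (measurableSet_contextualBand _ P),
    hrep _ (measurableSet_lt (by fun_prop) (by fun_prop))]
  gcongr 1
  refine le_trans (lintegral_mono_ae ?_)
    ((lintegral_gaussian_ratio_Icc_le μ ν hK1 hK2 ha0 ha1 ha2).trans (lintegral_mono_ae ?_))
  · filter_upwards [hz2] with z hz
    have hz : 0 < ‖z.2‖ := norm_pos_iff.2 hz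
    gcongr 1
    refine indicator_one_le_indicator_one fun h => ?_
    simp only [contextualBand, mem_ofPred_eq, hPe, hne, Submodule.norm_coe] at h
    push_cast at h
    rw [mem_Icc, le_div_iff₀ hz, div_le_one hz]
    constructor
    · refine (sq_le_sq₀ (by positivity) (norm_nonneg _)).1 ?_
      refine le_of_mul_le_mul_left ?_ hq
      rw [mul_pow, ← mul_assoc, ha2]
      linarith [h.1]
    · refine (sq_le_sq₀ (norm_nonneg _) hz.le).1 ?_
      linarith [h.2]
  · filter_upwards [hz2] with z hz
    have hz : 0 < ‖z.2‖ := norm_pos_iff.2 hz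
    gcongr 1
    refine indicator_one_le_indicator_one fun h => ?_
    simp only [mem_ofPred_eq, hPe, hne, Submodule.norm_coe]
    push_cast
    rw [mem_Iio, div_lt_iff₀ hz] at h
    have h2 : (q + 1) * ‖z.1‖ ^ 2 < (q + 1) * (a * ‖z.2‖) ^ 2 := by gcongr
    rw [mul_pow, ← mul_assoc, ha2] at h2
    linarith

/-- The band has at most the weight of the region below it, and the region above it has positive
weight. -/
theorem two_mul_gaussianWeight_contextual_lt (hr : 0 < r) (hrd : r < d)
    (hP : IsRankProjector r P) :
    2 * gaussianWeight d (contextualBand r P) <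
      gaussianWeight d univ := by
  set C := contextualBand r P with hC
  set A := {z : QSpace d | d * ‖P z‖ ^ 2 < r * ‖z‖ ^ 2} with hA
  set B := {z : QSpace d | ‖z‖ ^ 2 < 2 * ‖P z‖ ^ 2} with hB
  have hAm : MeasurableSet A := measurableSet_lt (by fun_prop) (by fun_prop)
  have hBo : IsOpen B := isOpen_lt (by fun_prop) (by fun_prop)
  have hd : (0 : ℝ) < d := by exact_mod_cast hr.trans hrd
  have hBne : B.Nonempty := by
    have : 0 < Module.finrank ℂ (P : QSpace d →ₗ[ℂ] QSpace d).range := by rw [hP.2]; exact hr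
    obtain ⟨⟨_, y, rfl⟩, hy⟩ := (Module.finrank_pos_iff_exists_ne_zero).1 this
    have h1 : P (P y) = P y := by
      have := congrArg (fun T : QOp d => T y) hP.1.isIdempotentElem.eq
      simpa using this
    have h2 : P y ≠ 0 := fun h => hy (Subtype.ext h)
    refine ⟨P y, ?_⟩
    have : 0 < ‖P y‖ ^ 2 := by positivity
    simp only [hB, mem_ofPred_eq, h1]
    linarith
  have hBpos := gaussianWeight_pos_of_isOpen hBo hBne
  rcases le_or_gt (2 * r) d with h | h
  · have hCA := gaussianWeight_contextual_le hr h hP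
    have hr2 : (2 : ℝ) * r ≤ d := by exact_mod_cast h
    have hAB : Disjoint A B := by
      rw [Set.disjoint_left]
      intro z hzA hzB
      simp only [hA, hB, mem_ofPred_eq] at hzA hzB
      have : 2 * r * ‖P z‖ ^ 2 ≤ d * ‖P z‖ ^ 2 := by gcongr
      have : (r : ℝ) * ‖z‖ ^ 2 ≤ r * (2 * ‖P z‖ ^ 2) := by gcongr
      linarith
    have hCAB : Disjoint C (A ∪ B) := by
      rw [Set.disjoint_left]
      rintro z ⟨h1, h2⟩ (h3 | h3)
      · exact h1.not_gt h3
      · exact h2.not_gt h3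
    calc 2 * gaussianWeight d C = gaussianWeight d C + gaussianWeight d C := two_mul _
      _ < gaussianWeight d C + (gaussianWeight d A + gaussianWeight d B) := by
          refine ENNReal.add_lt_add_left (measure_ne_top _ _) (hCA.trans_lt ?_)
          exact ENNReal.lt_add_right (measure_ne_top _ _) hBpos.ne'
      _ = gaussianWeight d (C ∪ (A ∪ B)) := by
          rw [measure_union hCAB (hAm.union hBo.measurableSet), measure_union hAB hBo.measurableSet]
      _ ≤ gaussianWeight d univ := measure_mono (subset_univ _)
  -- If `r / d > 1 / 2`, the band contains only the zero vector.
  · have hr2 : (d : ℝ) < 2 * r := by exact_mod_cast h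
    have hC0 : C ⊆ {0} := by
      rintro z ⟨h1, h2⟩
      by_contra hz
      have hz : 0 < ‖z‖ ^ 2 := by
        have : z ≠ 0 := hz
        positivity
      nlinarith
    have : Nonempty (Fin d) := ⟨⟨0, hr.trans hrd⟩⟩
    have hC : gaussianWeight d C = 0 :=
      measure_mono_null hC0 (withDensity_absolutelyContinuous _ _ (measure_singleton 0))
    rw [hC, mul_zero]
    exact hBpos.trans_le (measure_mono (subset_univ _))

end GaussianMeasure

/-- Averaging the number of contextual members of `S` over the Gaussian weight. -/
theorem exists_two_mul_contextualCount_lt {d r : ℕ} (hr : 0 < r) (hrd : r < d) {S : Finset (QOp d)}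
    (hS : S.Nonempty) (hSr : ∀ P ∈ S, IsRankProjector r P) :
    ∃ φ : QSpace d, 2 * contextualCount S (inheritedValuation (overlapValuation φ)) < S.card := by
  classical
  have hcount : ∀ φ : QSpace d,
      (contextualCount S (inheritedValuation (overlapValuation φ)) : ℝ≥0∞) ≤
        ∑ P ∈ S, (contextualBand r P).indicator 1 φ := by
    intro φ
    rw [contextualCount, Finset.card_filter, Nat.cast_sum]
    refine Finset.sum_le_sum fun P hP => ?_
    split_ifs with h
    · have : φ ∈ contextualBand r P :=
        bounds_of_inheritedValuation_eq_contextual hr (by omega) (hSr P hP) h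
      simp [this]
    · simp
  by_contra! hle
  have h1 : (S.card : ℝ≥0∞) * gaussianWeight d univ ≤
      ∑ P ∈ S, 2 * gaussianWeight d (contextualBand r P) := by
    calc (S.card : ℝ≥0∞) * gaussianWeight d univ
        = ∫⁻ _, (S.card : ℝ≥0∞) ∂(gaussianWeight d) := (lintegral_const _).symm
      _ ≤ ∫⁻ φ, ∑ P ∈ S, 2 * (contextualBand r P).indicator 1 φ ∂(gaussianWeight d) := by
          refine lintegral_mono fun φ => ?_
          rw [← Finset.mul_sum]
          refine le_trans ?_ (mul_le_mul_right (hcount φ) 2)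
          exact_mod_cast hle φ
      _ = ∑ P ∈ S, 2 * gaussianWeight d (contextualBand r P) := by
          rw [lintegral_finsetSum _ fun P _ =>
            (measurable_one.indicator (measurableSet_contextualBand r P)).const_mul 2]
          refine Finset.sum_congr rfl fun P _ => ?_
          rw [lintegral_const_mul _ (measurable_one.indicator (measurableSet_contextualBand r P)),
            lintegral_indicator_one (measurableSet_contextualBand r P)]
  refine h1.not_gt ?_
  rw [← nsmul_eq_mul, ← Finset.sum_const]
  exact ENNReal.sum_lt_sum_of_nonempty hS fun P hP =>
    two_mul_gaussianWeight_contextual_lt hr hrd (hSr P hP)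

end ContextualValuations

theorem mainTheorem4 (d r : ℕ) (hr : 0 < r) (hrd : r < d) :
    regIncBeta (1 / 2) (r : ℝ) ((d : ℝ) - (r : ℝ))
        - regIncBeta ((r : ℝ) / (d : ℝ)) (r : ℝ) ((d : ℝ) - (r : ℝ)) < 1 / 2 ∧
    ∀ S : Finset (QOp d), S.Nonempty → (∀ P ∈ S, IsRankProjector r P) →
      ∃ f : QOp d → Valuation01C,
        IsAdmissible (rankOneProjectors d) f ∧
        IsAdmissible (S : Set (QOp d)) (inheritedValuation f) ∧
        (contextualCount S (inheritedValuation f) : ℝ) / (S.card : ℝ) < 1 / 2 := by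
  refine ⟨?_, fun S hS hSr => ?_⟩
  · obtain ⟨p, rfl⟩ := Nat.exists_eq_succ_of_ne_zero hr.ne'
    obtain ⟨q, rfl⟩ : ∃ q, d = p + 1 + (q + 1) := ⟨d - p - 2, by omega⟩
    have hs : ((p + 1 + (q + 1) : ℕ) : ℝ) - (p.succ : ℕ) = q + 1 := by push_cast; ring
    rw [hs, Nat.cast_succ]
    refine regIncBeta_half_sub_mean_lt p q ?_
    push_cast
    field_simp
    ring
  · obtain ⟨φ, hφ⟩ := exists_two_mul_contextualCount_lt hr hrd hS hSr
    refine ⟨overlapValuation φ, isAdmissible_overlapValuation (by omega) φ,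
      isAdmissible_inheritedValuation hr (by omega) hSr φ, ?_⟩
    have hcard : (0 : ℝ) < S.card := by exact_mod_cast hS.card_pos
    have hφ' : (2 : ℝ) * contextualCount S (inheritedValuation (overlapValuation φ)) < S.card := by
      exact_mod_cast hφ
    rw [div_lt_iff₀ hcard]
    linarith
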